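/- Let $n\ge 1$ and let $S_n$ be the set of permutations $\sigma=\sigma_1\cdots\sigma_n$ of $[n]=\{1,\dots,n\}$, with the convention $\sigma_0=0$. For $\sigma\in S_n$ put $$\overline{L}(\sigma)=\{\sigma_i : 1\le i\le n,\ \sigma_{i-1}+1=\sigma_i\},\qquad F(\sigma)=\{i : 1\le i\le n,\ \sigma_i=i\},$$ $$\overline{\mathrm{Jump}}(\sigma)=\{\sigma_i : 1\le i\le n,\ \sigma_{i-1}+2\le\sigma_i\},\qquad \overline{\mathrm{Exc}}(\sigma)=\{\sigma_i : 1\le i\le n,\ \sigma_i>i\}.$$ Let $\mathrm{jump}(\sigma)$ be the number of $i\in[n]$ with $\sigma_{i-1}+2\le\sigma_i$, let $\mathrm{des}(\sigma)$ be the number of $i\in[n-1]$ with $\sigma_i>\sigma_{i+1}$, and let $\mathrm{exc}(\sigma)$ and $\mathrm{drop}(\sigma)$ be the numbers of $i\in[n]$ with $\sigma_i>i$ and with $\sigma_i<i$, respectively. For $I\subseteq[n]$ let $\overline{L}_n(I)=\{\sigma\in S_n:\overline{L}(\sigma)=I\}$ and $F_n(I)=\{\sigma\in S_n: F(\sigma)=I\}$.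 Then for every $I\subseteq[n]$ there is a bijection $\Phi:\overline{L}_n(I)\to F_n(I)$ such that for every $\sigma\in\overline{L}_n(I)$, $$\mathrm{jump}(\sigma)=\mathrm{exc}(\Phi(\sigma)),\qquad \mathrm{des}(\sigma)=\mathrm{drop}(\Phi(\sigma)),\qquad \overline{\mathrm{Jump}}(\sigma)=\overline{\mathrm{Exc}}(\Phi(\sigma)).$$ -/

import Mathlib

namespace LeftSuccession

/-- A permutation `σ` of `[n] = {1, …, n}` is an element of `Equiv.Perm (Fin n)`, where the
element `k` of `[n]` is represented by `k - 1 : Fin n`. In these terms `entry σ i` is the entry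
`σ_i` of the word `σ_1 ⋯ σ_n` for `1 ≤ i ≤ n`, and `σ_0 = 0` by convention
(the value at indices `i > n`, never used below, is also `0`). -/
def entry {n : ℕ} (σ : Equiv.Perm (Fin n)) (i : ℕ) : ℕ :=
  if h : 1 ≤ i ∧ i ≤ n then (σ ⟨i - 1, by omega⟩ : ℕ) + 1 else 0

/-- The set of values `σ_i`, `1 ≤ i ≤ n`, at the left successions: `σ_{i-1} + 1 = σ_i`. -/
def leftSuccValues {n : ℕ} (σ : Equiv.Perm (Fin n)) : Finset ℕ :=
  ((Finset.Icc 1 n).filter (fun i => entry σ (i - 1) + 1 = entry σ i)).image (entry σ)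

/-- The set of jumps: indices `1 ≤ i ≤ n` with `σ_{i-1} + 2 ≤ σ_i`. -/
def jumps {n : ℕ} (σ : Equiv.Perm (Fin n)) : Finset ℕ :=
  (Finset.Icc 1 n).filter (fun i => entry σ (i - 1) + 2 ≤ entry σ i)

/-- The set of descents: indices `1 ≤ i ≤ n - 1` with `σ_i > σ_{i+1}`. -/
def descents {n : ℕ} (σ : Equiv.Perm (Fin n)) : Finset ℕ :=
  (Finset.Icc 1 (n - 1)).filter (fun i => entry σ i > entry σ (i + 1))

/-- The set of excedances: indices `1 ≤ i ≤ n` with `σ_i > i`. -/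
def excedances {n : ℕ} (σ : Equiv.Perm (Fin n)) : Finset ℕ :=
  (Finset.Icc 1 n).filter (fun i => entry σ i > i)

/-- The set of drops: indices `1 ≤ i ≤ n` with `σ_i < i`. -/
def drops {n : ℕ} (σ : Equiv.Perm (Fin n)) : Finset ℕ :=
  (Finset.Icc 1 n).filter (fun i => entry σ i < i)

/-- The set of fixed points: indices `1 ≤ i ≤ n` with `σ_i = i`. -/
def fixedPoints {n : ℕ} (σ : Equiv.Perm (Fin n)) : Finset ℕ :=
  (Finset.Icc 1 n).filter (fun i => entry σ i = i)

/-- The set of jump values `σ_i`, for `i` a jump. -/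
def jumpValues {n : ℕ} (σ : Equiv.Perm (Fin n)) : Finset ℕ := (jumps σ).image (entry σ)

/-- The set of excedance values `σ_i`, for `i` an excedance. -/
def excValues {n : ℕ} (σ : Equiv.Perm (Fin n)) : Finset ℕ := (excedances σ).image (entry σ)

/-- The number of jumps. -/
def jump {n : ℕ} (σ : Equiv.Perm (Fin n)) : ℕ := (jumps σ).card

/-- The number of descents. -/
def des {n : ℕ} (σ : Equiv.Perm (Fin n)) : ℕ := (descents σ).card

/-- The number of excedances. -/
def exc {n : ℕ} (σ : Equiv.Perm (Fin n)) : ℕ := (excedances σ).card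

/-- The number of drops. -/
def drop {n : ℕ} (σ : Equiv.Perm (Fin n)) : ℕ := (drops σ).card

/-- The set of permutations of `[n]` whose set of left-succession values is `I`. -/
def leftSuccPerms (n : ℕ) (I : Finset ℕ) : Set (Equiv.Perm (Fin n)) :=
  {σ | leftSuccValues σ = I}

/-- The set of permutations of `[n]` whose set of fixed points is `I`. -/
def fixPerms (n : ℕ) (I : Finset ℕ) : Set (Equiv.Perm (Fin n)) :=
  {σ | fixedPoints σ = I}

end LeftSuccession

namespace LeftSuccession

/-! ### Words with the convention σ_0 = 0. -/

section Entries

variable {n : ℕ} (σ : Equiv.Perm (Fin n))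

/-! Build a bijection `Ψ` of S_n recursively. If n + 1 is inserted into the word of σ right after
σ_p (with σ_0 = 0), then on the other side insert n + 1 into the cycles of τ = `Ψ σ` as the image of
σ_p + 1. The word gains the ascent (σ_p, n + 1) and loses the pair (σ_p, σ_{p+1}); the permutation
gains the excedance σ_p + 1 ↦ n + 1 (a fixed point if σ_p = n), and the old image of σ_p + 1 becomes
the image of n + 1, a drop. Hence ascents (x, y) of 0σ correspond to weak excedances x + 1 ↦ y of τ
(`AscentsMatch.insert`). Ascents with y = x + 1 are the fixed points and the others are the
excedances, with the same values y. Descents and drops are what remains of n on each side. -/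

lemma entry_succ (i : Fin n) : entry σ (i + 1) = σ i + 1 := by
  have h : 1 ≤ (i : ℕ) + 1 ∧ (i : ℕ) + 1 ≤ n := by omega
  simp [entry, h]

lemma entry_zero : entry σ 0 = 0 := by simp [entry]

lemma one_le_entry {i : ℕ} (h : 1 ≤ i) (hi : i ≤ n) : 1 ≤ entry σ i := by
  simp [entry, h, hi]

lemma entry_le (i : ℕ) : entry σ i ≤ n := by
  unfold entry
  split_ifs <;> omega

/-- Index 0 is included: σ_0 = 0 differs from every true letter, so σ_0, …, σ_n are n + 1 distinct
values filling {0, …, n}. -/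
lemma entry_injOn {i j : ℕ} (hi : i ≤ n) (hj : j ≤ n) (h : entry σ i = entry σ j) : i = j := by
  rcases i with _ | i <;> rcases j with _ | j
  · rfl
  · have := one_le_entry σ (i := j + 1) (by omega) hj
    rw [entry_zero] at h
    omega
  · have := one_le_entry σ (i := i + 1) (by omega) hi
    rw [entry_zero] at h
    omega
  · have h1 := entry_succ σ ⟨i, hi⟩
    have h2 := entry_succ σ ⟨j, hj⟩
    simp only at h1 h2
    have h3 : σ ⟨i, hi⟩ = σ ⟨j, hj⟩ := Fin.ext (by omega)
    simpa using σ.injective h3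

end Entries

/-! ### Inserting the largest letter into a word or into a cycle. -/

section Insertion

variable {n : ℕ}

/-- Insert the new largest letter into the word of `σ`, at the (zero-based) position `p`. -/
def insertMax (p : Fin (n + 1)) (σ : Equiv.Perm (Fin n)) : Equiv.Perm (Fin (n + 1)) :=
  (finSuccEquiv' p).trans ((Equiv.optionCongr σ).trans (finSuccEquiv' (Fin.last n)).symm)

lemma insertMax_self (p : Fin (n + 1)) (σ : Equiv.Perm (Fin n)) :
    insertMax p σ p = Fin.last n := by
  simp [insertMax]

lemma insertMax_succAbove (p : Fin (n + 1)) (σ : Equiv.Perm (Fin n)) (i : Fin n) :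
    insertMax p σ (p.succAbove i) = (σ i).castSucc := by
  simp [insertMax]

lemma insertMax_injective :
    Function.Injective (fun x : Fin (n + 1) × Equiv.Perm (Fin n) => insertMax x.1 x.2) := by
  rintro ⟨p, σ⟩ ⟨q, τ⟩ h
  simp only at h
  have hpq : p = q := by
    apply (insertMax q τ).injective
    rw [insertMax_self, ← h, insertMax_self]
  subst hpq
  have : σ = τ := by
    ext i
    have := insertMax_succAbove p σ i
    rw [h, insertMax_succAbove] at this
    rw [Fin.castSucc_injective n this]
  rw [this]

lemma insertMax_bijective :
    Function.Bijective (fun x : Fin (n + 1) × Equiv.Perm (Fin n) => insertMax x.1 x.2) := by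
  rw [Fintype.bijective_iff_injective_and_card]
  exact ⟨insertMax_injective, by simp [Fintype.card_perm, Nat.factorial_succ]⟩

lemma entry_insertMax_self (p : Fin (n + 1)) (σ : Equiv.Perm (Fin n)) :
    entry (insertMax p σ) (p + 1) = n + 1 := by
  rw [entry_succ, insertMax_self, Fin.val_last]

lemma entry_insertMax_of_le (p : Fin (n + 1)) (σ : Equiv.Perm (Fin n)) {i : ℕ} (hi : i ≤ p) :
    entry (insertMax p σ) i = entry σ i := by
  rcases i with _ | i
  · simp [entry_zero]
  · have hin : i < n := by omega
    have h1 : p.succAbove ⟨i, hin⟩ = Fin.castSucc ⟨i, hin⟩ :=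
      Fin.succAbove_of_castSucc_lt _ _ (by simp [Fin.lt_def]; omega)
    have h2 := entry_succ (insertMax p σ) (Fin.castSucc ⟨i, hin⟩)
    rw [← h1, insertMax_succAbove, h1] at h2
    simpa using h2.trans (entry_succ σ ⟨i, hin⟩).symm

lemma entry_insertMax_of_lt (p : Fin (n + 1)) (σ : Equiv.Perm (Fin n)) {i : ℕ} (hi : p < i)
    (hin : i ≤ n) : entry (insertMax p σ) (i + 1) = entry σ i := by
  obtain ⟨i, rfl⟩ : ∃ j, i = j + 1 := ⟨i - 1, by omega⟩
  have h1 : p.succAbove ⟨i, hin⟩ = Fin.succ ⟨i, hin⟩ :=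
    Fin.succAbove_of_le_castSucc _ _ (by simp [Fin.le_def]; omega)
  have h2 := entry_succ (insertMax p σ) (Fin.succ ⟨i, hin⟩)
  rw [← h1, insertMax_succAbove, h1] at h2
  simpa using h2.trans (entry_succ σ ⟨i, hin⟩).symm

/-- Insert the new largest letter into the cycle structure of `τ`, with preimage `a`. -/
def insertMaxCycle (a : Fin (n + 1)) (τ : Equiv.Perm (Fin n)) : Equiv.Perm (Fin (n + 1)) :=
  (Equiv.swap a (Fin.last n)).trans (insertMax (Fin.last n) τ)

lemma insertMaxCycle_injective :
    Function.Injective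
      (fun x : Fin (n + 1) × Equiv.Perm (Fin n) => insertMaxCycle x.1 x.2) := by
  rintro ⟨a, σ⟩ ⟨b, τ⟩ h
  simp only at h
  have hself : ∀ (c : Fin (n + 1)) (ρ : Equiv.Perm (Fin n)),
      insertMaxCycle c ρ c = Fin.last n := fun c ρ => by
    simp [insertMaxCycle, insertMax_self]
  have hab : a = b := by
    apply (insertMaxCycle b τ).injective
    rw [hself, ← h, hself]
  subst hab
  have h' : insertMax (Fin.last n) σ = insertMax (Fin.last n) τ := by
    ext i
    have := congrArg (fun ρ : Equiv.Perm (Fin (n + 1)) => ρ (Equiv.swap a (Fin.last n) i)) h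
    simp only [insertMaxCycle, Equiv.trans_apply, Equiv.swap_apply_self] at this
    rw [this]
  have := @insertMax_injective n (Fin.last n, σ) (Fin.last n, τ) h'
  simpa using this

lemma entry_insertMaxCycle_self (a : Fin (n + 1)) (τ : Equiv.Perm (Fin n)) :
    entry (insertMaxCycle a τ) (a + 1) = n + 1 := by
  rw [entry_succ]
  simp [insertMaxCycle, insertMax_self]

/-- For a = n the swap is trivial and n + 1 becomes a fixed point, hence the bound on `a`. -/
lemma entry_insertMaxCycle_last (a : Fin (n + 1)) (τ : Equiv.Perm (Fin n)) (ha : (a : ℕ) < n) :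
    entry (insertMaxCycle a τ) (n + 1) = entry τ (a + 1) := by
  have h := entry_succ (insertMaxCycle a τ) (Fin.last n)
  rw [Fin.val_last] at h
  rw [h, ← entry_insertMax_of_le (Fin.last n) τ (i := a + 1) (by simpa using ha), entry_succ]
  simp [insertMaxCycle]

lemma entry_insertMaxCycle_of_ne (a : Fin (n + 1)) (τ : Equiv.Perm (Fin n)) {k : ℕ}
    (hk : k ≤ n) (hka : k ≠ a + 1) : entry (insertMaxCycle a τ) k = entry τ k := by
  rcases k with _ | k
  · simp [entry_zero]
  · rw [← entry_insertMax_of_le (Fin.last n) τ (i := k + 1) (by simpa using hk)]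
    have h1 := entry_succ (insertMaxCycle a τ) ⟨k, by omega⟩
    have h2 := entry_succ (insertMax (Fin.last n) τ) ⟨k, by omega⟩
    simp only at h1 h2
    rw [h1, h2, insertMaxCycle, Equiv.trans_apply, Equiv.swap_apply_of_ne_of_ne]
    · intro h
      apply hka
      rw [← h]
    · intro h
      have := congrArg Fin.val h
      simp at this
      omega

end Insertion

/-! ### The invariant and the recursive bijection. -/

/-- The ascents `σ_{i-1} < σ_i` of the word `0 σ_1 ⋯ σ_n` are exactly the weak excedances
`k ↦ τ_k` of `τ`, under `(σ_{i-1} + 1, σ_i) = (k, τ_k)`. -/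
def AscentsMatch {n : ℕ} (σ τ : Equiv.Perm (Fin n)) : Prop :=
  (∀ i, 1 ≤ i → i ≤ n → entry σ (i - 1) < entry σ i →
    entry τ (entry σ (i - 1) + 1) = entry σ i) ∧
  (∀ k, 1 ≤ k → k ≤ n → k ≤ entry τ k →
    ∃ i, 1 ≤ i ∧ i ≤ n ∧ entry σ (i - 1) + 1 = k ∧ entry σ i = entry τ k)

/-- Only the pair starting at σ_p and the image of σ_p + 1 are disturbed. The new pair starting at n
+ 1 is a descent and the new image of n + 1 is at most n unless σ_p = n, so neither creates anything
to match. -/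
lemma AscentsMatch.insert {n : ℕ} {σ τ : Equiv.Perm (Fin n)} (h : AscentsMatch σ τ)
    {p a : Fin (n + 1)} (ha : (a : ℕ) = entry σ p) :
    AscentsMatch (insertMax p σ) (insertMaxCycle a τ) := by
  obtain ⟨hasc, hexc⟩ := h
  have hp : (p : ℕ) ≤ n := by omega
  constructor
  · intro i hi1 hin hlt
    rcases lt_trichotomy i (p + 1) with hip | rfl | hip
    · rw [entry_insertMax_of_le p σ (i := i - 1) (by omega),
        entry_insertMax_of_le p σ (i := i) (by omega)] at *
      have hle := entry_le σ i
      rw [entry_insertMaxCycle_of_ne a τ (by omega)]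
      · exact hasc i hi1 (by omega) hlt
      · intro he
        have := entry_injOn σ (i := i - 1) (j := p) (by omega) hp (by omega)
        omega
    · rw [entry_insertMax_self, Nat.add_sub_cancel, entry_insertMax_of_le p σ le_rfl, ← ha,
        entry_insertMaxCycle_self]
    · obtain ⟨j, rfl⟩ : ∃ j, i = j + 1 := ⟨i - 1, by omega⟩
      rw [Nat.add_sub_cancel, entry_insertMax_of_lt p σ (i := j) (by omega) (by omega)] at *
      have hle := entry_le σ j
      rcases eq_or_ne j (p + 1) with rfl | hj
      -- The letter just after n + 1 cannot end an ascent.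
      · rw [entry_insertMax_self] at hlt
        omega
      · obtain ⟨l, rfl⟩ : ∃ l, j = l + 1 := ⟨j - 1, by omega⟩
        rw [entry_insertMax_of_lt p σ (i := l) (by omega) (by omega)] at *
        rw [entry_insertMaxCycle_of_ne a τ (by omega)]
        · simpa using hasc (l + 1) (by omega) (by omega) (by simpa using hlt)
        · intro he
          have := entry_injOn σ (i := l) (j := p) (by omega) hp (by omega)
          omega
  · intro k hk1 hkn hk
    rcases eq_or_ne k (a + 1) with rfl | hka
    · refine ⟨p + 1, by omega, by omega, ?_, ?_⟩
      · rw [Nat.add_sub_cancel, entry_insertMax_of_le p σ le_rfl, ha]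
      · rw [entry_insertMax_self, entry_insertMaxCycle_self]
    rcases eq_or_ne k (n + 1) with rfl | hkn'
    -- Here a < n, so n + 1 maps to an old value and is a drop.
    · rw [entry_insertMaxCycle_last a τ (by omega)] at hk
      have := entry_le τ (a + 1)
      omega
    rw [entry_insertMaxCycle_of_ne a τ (by omega) hka] at *
    obtain ⟨i, hi1, hin, hik, hiv⟩ := hexc k hk1 (by omega) hk
    have hip : i ≠ p + 1 := by
      rintro rfl
      rw [Nat.add_sub_cancel] at hik
      omega
    rcases lt_or_gt_of_ne hip with hip | hip
    · refine ⟨i, hi1, by omega, ?_, ?_⟩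
      · rw [entry_insertMax_of_le p σ (by omega), hik]
      · rw [entry_insertMax_of_le p σ (by omega), hiv]
    · refine ⟨i + 1, by omega, by omega, ?_, ?_⟩
      · obtain ⟨j, rfl⟩ : ∃ j, i = j + 1 := ⟨i - 1, by omega⟩
        rw [Nat.add_sub_cancel] at *
        rw [entry_insertMax_of_lt p σ (by omega) (by omega), hik]
      · rw [entry_insertMax_of_lt p σ (by omega) hin, hiv]

theorem exists_perm_equiv_ascentsMatch (n : ℕ) :
    ∃ Ψ : Equiv.Perm (Fin n) ≃ Equiv.Perm (Fin n), ∀ σ, AscentsMatch σ (Ψ σ) := by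
  induction n with
  | zero => exact ⟨Equiv.refl _, fun σ => ⟨fun i _ _ => by omega, fun k _ _ => by omega⟩⟩
  | succ n ih =>
    obtain ⟨Ψ, hΨ⟩ := ih
    let e := Equiv.ofBijective _ (insertMax_bijective (n := n))
    -- The insertion position p is traded for the letter σ_p; this is injective since σ_0, …, σ_n
    -- are distinct.
    let pre : Fin (n + 1) × Equiv.Perm (Fin n) → Fin (n + 1) × Equiv.Perm (Fin n) :=
      fun x => (⟨entry x.2 x.1, Nat.lt_succ_of_le (entry_le x.2 x.1)⟩, Ψ x.2)
    have hpre : Function.Injective pre := by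
      rintro ⟨p, σ⟩ ⟨q, τ⟩ h
      simp only [pre, Prod.mk.injEq, Fin.mk.injEq, EmbeddingLike.apply_eq_iff_eq] at h
      obtain ⟨hpq, rfl⟩ := h
      have := entry_injOn σ (by omega) (by omega) hpq
      rw [Fin.ext this]
    have hinj : Function.Injective (fun σ => insertMaxCycle (pre (e.symm σ)).1 (pre (e.symm σ)).2) :=
      (insertMaxCycle_injective.comp hpre).comp e.symm.injective
    refine ⟨Equiv.ofBijective _ (Finite.injective_iff_bijective.mp hinj), fun σ => ?_⟩
    obtain ⟨x, rfl⟩ := e.surjective σ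
    simp only [Equiv.ofBijective_apply, Equiv.symm_apply_apply]
    exact (hΨ x.2).insert rfl

/-! ### Reading the statistics off the invariant. -/

section Statistics

variable {n : ℕ}

lemma AscentsMatch.leftSuccValues_eq {σ τ : Equiv.Perm (Fin n)} (h : AscentsMatch σ τ) :
    leftSuccValues σ = fixedPoints τ := by
  ext v
  simp only [leftSuccValues, fixedPoints, Finset.mem_image, Finset.mem_filter, Finset.mem_Icc]
  constructor
  · rintro ⟨i, ⟨⟨hi1, hin⟩, hs⟩, rfl⟩
    have := h.1 i hi1 hin (by omega)
    exact ⟨⟨one_le_entry σ hi1 hin, entry_le σ i⟩, by rwa [hs] at this⟩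
  · rintro ⟨⟨h1, hn⟩, hv⟩
    obtain ⟨i, hi1, hin, h2, h3⟩ := h.2 v h1 hn (by omega)
    exact ⟨i, ⟨⟨hi1, hin⟩, by omega⟩, by omega⟩

lemma AscentsMatch.jumpValues_eq {σ τ : Equiv.Perm (Fin n)} (h : AscentsMatch σ τ) :
    jumpValues σ = excValues τ := by
  ext v
  simp only [jumpValues, jumps, excValues, excedances, Finset.mem_image, Finset.mem_filter,
    Finset.mem_Icc]
  constructor
  · rintro ⟨i, ⟨⟨hi1, hin⟩, hs⟩, rfl⟩
    have h1 := h.1 i hi1 hin (by omega)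
    have h2 := entry_le σ i
    exact ⟨entry σ (i - 1) + 1, ⟨⟨by omega, by omega⟩, by omega⟩, h1⟩
  · rintro ⟨k, ⟨⟨h1, hn⟩, hk⟩, rfl⟩
    obtain ⟨i, hi1, hin, h2, h3⟩ := h.2 k h1 hn (by omega)
    exact ⟨i, ⟨⟨hi1, hin⟩, by omega⟩, h3⟩

lemma card_image_entry (σ : Equiv.Perm (Fin n)) {s : Finset ℕ} (hs : s ⊆ Finset.Icc 1 n) :
    (s.image (entry σ)).card = s.card := by
  refine Finset.card_image_of_injOn fun i hi j hj hij => ?_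
  have h1 := Finset.mem_Icc.mp (hs hi)
  have h2 := Finset.mem_Icc.mp (hs hj)
  exact entry_injOn σ h1.2 h2.2 hij

lemma card_jumpValues (σ : Equiv.Perm (Fin n)) : (jumpValues σ).card = jump σ :=
  card_image_entry σ (Finset.filter_subset _ _)

lemma card_excValues (σ : Equiv.Perm (Fin n)) : (excValues σ).card = exc σ :=
  card_image_entry σ (Finset.filter_subset _ _)

lemma card_fixedPoints_add (τ : Equiv.Perm (Fin n)) :
    (fixedPoints τ).card + exc τ + drop τ = n := by
  have h : (Finset.Icc 1 n).card = n := by simp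
  conv_rhs => rw [← h]
  rw [exc, drop, ← Finset.card_union_of_disjoint, ← Finset.card_union_of_disjoint]
  · congr 1
    ext i
    simp only [fixedPoints, excedances, drops, Finset.mem_union, Finset.mem_filter]
    grind
  · simp only [fixedPoints, excedances, drops, Finset.disjoint_left, Finset.mem_union,
      Finset.mem_filter]
    grind
  · simp only [fixedPoints, excedances, Finset.disjoint_left, Finset.mem_filter]
    grind

/-- Shift the index by one; index 1 never qualifies because σ_0 = 0. -/
lemma des_eq_card (σ : Equiv.Perm (Fin n)) :
    des σ = ((Finset.Icc 1 n).filter (fun i => entry σ i < entry σ (i - 1))).card := by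
  refine Finset.card_bij (fun i _ => i + 1) ?_ (fun _ _ _ _ h => by omega) ?_
  · intro i hi
    simp only [descents, Finset.mem_filter, Finset.mem_Icc, Nat.add_sub_cancel] at hi ⊢
    exact ⟨by omega, hi.2⟩
  · intro j hj
    simp only [Finset.mem_filter, Finset.mem_Icc] at hj
    obtain ⟨⟨h1, hn⟩, hj⟩ := hj
    have hj1 : j ≠ 1 := by
      rintro rfl
      simp [entry_zero] at hj
    refine ⟨j - 1, ?_, by omega⟩
    simp only [descents, Finset.mem_filter, Finset.mem_Icc]
    rw [Nat.sub_add_cancel h1]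
    exact ⟨by omega, hj⟩

lemma card_leftSuccValues_add (σ : Equiv.Perm (Fin n)) :
    (leftSuccValues σ).card + jump σ + des σ = n := by
  have h : (Finset.Icc 1 n).card = n := by simp
  conv_rhs => rw [← h]
  rw [leftSuccValues, card_image_entry σ (Finset.filter_subset _ _), jump, des_eq_card,
    ← Finset.card_union_of_disjoint, ← Finset.card_union_of_disjoint]
  · congr 1
    ext i
    simp only [jumps, Finset.mem_union, Finset.mem_filter, Finset.mem_Icc]
    constructor
    · tauto
    · rintro ⟨h1, hn⟩
      have : entry σ (i - 1) ≠ entry σ i := fun he => by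
        have := entry_injOn σ (by omega) hn he
        omega
      have : entry σ (i - 1) + 1 = entry σ i ∨ entry σ (i - 1) + 2 ≤ entry σ i ∨
        entry σ i < entry σ (i - 1) := by omega
      tauto
  · simp only [jumps, Finset.disjoint_left, Finset.mem_union, Finset.mem_filter]
    grind
  · simp only [jumps, Finset.disjoint_left, Finset.mem_filter]
    grind

end Statistics

end LeftSuccession

theorem theorem4p3 (n : ℕ) (hn : 1 ≤ n) (I : Finset ℕ) (hI : I ⊆ Finset.Icc 1 n) :
    ∃ Φ : LeftSuccession.leftSuccPerms n I ≃ LeftSuccession.fixPerms n I,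
      ∀ σ : LeftSuccession.leftSuccPerms n I,
        LeftSuccession.jump σ.1 = LeftSuccession.exc (Φ σ).1 ∧
        LeftSuccession.des σ.1 = LeftSuccession.drop (Φ σ).1 ∧
        LeftSuccession.jumpValues σ.1 = LeftSuccession.excValues (Φ σ).1 := by
  obtain ⟨Ψ, hΨ⟩ := LeftSuccession.exists_perm_equiv_ascentsMatch n
  refine ⟨Ψ.subtypeEquiv fun σ => ?_, fun σ => ?_⟩
  · change LeftSuccession.leftSuccValues σ = I ↔ LeftSuccession.fixedPoints (Ψ σ) = I
    rw [(hΨ σ).leftSuccValues_eq]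
  · rw [Equiv.subtypeEquiv_apply]
    have hv := (hΨ σ.1).jumpValues_eq
    have hL := congrArg Finset.card (hΨ σ.1).leftSuccValues_eq
    have hj : LeftSuccession.jump σ.1 = LeftSuccession.exc (Ψ σ.1) := by
      rw [← LeftSuccession.card_jumpValues, hv, LeftSuccession.card_excValues]
    have h1 := LeftSuccession.card_leftSuccValues_add σ.1
    have h2 := LeftSuccession.card_fixedPoints_add (Ψ σ.1)
    -- Both are n minus the same two counts.
    have hd : LeftSuccession.des σ.1 = LeftSuccession.drop (Ψ σ.1) := by omega
    exact ⟨hj, hd, hv⟩
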